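/- Consider the Bayesian $K$-armed bandit, $K\ge 1$. The mean vector $\theta\in\mathbb{R}^K$ is drawn from an arbitrary known prior $q$ supported on $[0,1]^K$; given $\theta$, each pull of arm $a$ yields a reward drawn, independently of the past, from a known distribution on $[0,1]$, determined by $\theta$ and $a$, with mean $\theta_a$. A policy chooses the arm $A_t$ of round $t$ at random with a distribution that depends only on the history $H_t=(A_1,R_1(A_1),\dots,A_{t-1},R_{t-1}(A_{t-1}))$, and its Bayes regret is $$\mathrm{BayesRegret}(T,\pi)=\sum_{t=1}^T\mathbb{E}\bigl[\max_a\theta_a-\theta_{A_t}\bigr].$$ Let $T\ge K$, let $N_t(a)$ be the number of pulls of $a$ before round $t$, $\hat\mu_t(a)$ the average of the rewards obtained from them, $U_t(a)=\hat\mu_t(a)+\sqrt{3\log T/N_t(a)}$, and $\mathrm{radius}_t(a)=U_t(a)-\hat\mu_t(a)$. For an integer $m\ge 1$, the policy TS-UCB pulls every arm once in the first $K$ rounds; in each round $t>K$ it draws $m$ independent samples $\tilde\theta_1,\dots,\tilde\theta_m$ from the posterior distribution of $\theta$ given $H_t$, sets $\tilde f_t=\frac1m\sum_{i=1}^m\max_a\tilde\theta_{i,a}$,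 and pulls an arm that minimizes $$\Psi_t(a)=\frac{\tilde f_t-\hat\mu_t(a)}{\mathrm{radius}_t(a)}$$ (ties broken in any way). Then, for every $m\ge1$, $$\mathrm{BayesRegret}(T,\pi^{\mathrm{TS\text{-}UCB}})\le 4\sqrt{3KT\log T}+T^{-2}+3\sqrt T+K .$$ Moreover the right-hand side is $O(\sqrt{KT\log T})$: there is an absolute constant $C$ such that it is at most $C\sqrt{KT\log T}$ whenever $1\le K\le T$ and $T\ge 2$. -/

import Mathlib

open MeasureTheory ProbabilityTheory

namespace Bandit

/-- The vector of mean rewards of the `K` arms. -/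
abbrev Param (K : ℕ) : Type := Fin K → ℝ

/-- The observations of the first `t` rounds: for each round, the arm pulled and the reward
received. -/
abbrev Hist (K t : ℕ) : Type := Fin t → Fin K × ℝ

/-- The Bayesian `K`-armed bandit with rewards in `[0, 1]`: an arbitrary prior on the mean vector
`θ`, supported on `[0, 1]^K`, and for each `θ` and each arm `a` a reward distribution on `[0, 1]`
whose mean is `θ a`. -/
structure Model (K : ℕ) where
  prior : Measure (Param K)
  reward : Kernel (Param K × Fin K) ℝ
  prior_prob : IsProbabilityMeasure prior
  reward_markov : IsMarkovKernel reward
  prior_support : ∀ᵐ θ ∂prior, ∀ a, θ a ∈ Set.Icc (0 : ℝ) 1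
  reward_support : ∀ᵐ θ ∂prior, ∀ a, ∀ᵐ x ∂(reward (θ, a)), x ∈ Set.Icc (0 : ℝ) 1
  reward_mean : ∀ᵐ θ ∂prior, ∀ a, ∫ x, x ∂(reward (θ, a)) = θ a

attribute [instance] Model.prior_prob Model.reward_markov

/-- A policy: `act t h` is the distribution of the arm pulled in round `t + 1`, when `h` is the
history of the first `t` rounds. -/
structure Policy (K : ℕ) where
  act : (t : ℕ) → Kernel (Hist K t) (Fin K)
  act_markov : ∀ t, IsMarkovKernel (act t)

attribute [instance] Policy.act_markov

variable {K : ℕ}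

/-- Append the observation of a further round to a history. -/
def extend {t : ℕ} (p : Hist K t × (Fin K × ℝ)) : Hist K (t + 1) :=
  Fin.snoc (α := fun _ => Fin K × ℝ) p.1 p.2

theorem measurable_extend {t : ℕ} : Measurable (extend (K := K) (t := t)) := by
  refine measurable_pi_iff.2 fun i => ?_
  refine Fin.lastCases ?_ (fun j => ?_) i
  · simpa [extend] using measurable_snd
  · simp only [extend, Fin.snoc_castSucc]
    fun_prop

/-- One round: given `θ` and the history, the arm is drawn from the policy, which sees the history
only, and then the reward is drawn from the reward distribution of that arm under `θ`,
independently of the past. -/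
noncomputable def round (B : Model K) (π : Policy K) (t : ℕ) :
    Kernel (Param K × Hist K t) (Fin K × ℝ) :=
  ((π.act t).comap Prod.snd measurable_snd) ⊗ₖ
    (B.reward.comap (fun p : (Param K × Hist K t) × Fin K => (p.1.1, p.2)) (by fun_prop))

instance (B : Model K) (π : Policy K) (t : ℕ) : IsMarkovKernel (round B π t) := by
  unfold round; infer_instance

/-- The distribution, given `θ`, of the history of the first `t` rounds under the policy `π`. -/
noncomputable def histKernel (B : Model K) (π : Policy K) : (t : ℕ) → Kernel (Param K) (Hist K t)
  | 0 => Kernel.const _ (Measure.dirac Fin.elim0)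
  | t + 1 => (histKernel B π t ⊗ₖ round B π t).map extend

instance instMarkovHist (B : Model K) (π : Policy K) (t : ℕ) :
    IsMarkovKernel (histKernel B π t) := by
  induction t with
  | zero => unfold histKernel; infer_instance
  | succ t ih => unfold histKernel; exact Kernel.IsMarkovKernel.map _ measurable_extend

/-- The unconditional distribution of the history of the first `t` rounds. -/
noncomputable def histLaw (B : Model K) (π : Policy K) (t : ℕ) : Measure (Hist K t) :=
  (histKernel B π t) ∘ₘ B.prior

/-- The posterior distribution of `θ`, given the history of the first `t` rounds. -/
noncomputable def post (B : Model K) (π : Policy K) (t : ℕ) : Kernel (Hist K t) (Param K) :=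
  (histKernel B π t)†B.prior

/-- An optimal arm for the mean vector `θ`. -/
noncomputable def optArm [NeZero K] (θ : Param K) : Fin K := (Finite.exists_max θ).choose

theorem le_optArm [NeZero K] (θ : Param K) (a : Fin K) : θ a ≤ θ (optArm θ) :=
  (Finite.exists_max θ).choose_spec a

/-- The `T`-period regret of `π` given `θ`. -/
noncomputable def regret [NeZero K] (B : Model K) (T : ℕ) (π : Policy K) (θ : Param K) : ℝ :=
  ∑ t ∈ Finset.range T,
    ∫ h, (∫ a, (θ (optArm θ) - θ a) ∂(π.act t h)) ∂(histKernel B π t θ)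

/-- The `T`-period Bayes regret of `π`. -/
noncomputable def bayesRegret [NeZero K] (B : Model K) (T : ℕ) (π : Policy K) : ℝ :=
  ∫ θ, regret B T π θ ∂B.prior

/-- The number of pulls of the arm `a`. -/
def pulls {t : ℕ} (h : Hist K t) (a : Fin K) : ℕ :=
  (Finset.univ.filter fun s => (h s).1 = a).card

/-- The empirical mean reward of the arm `a`. -/
noncomputable def empMean {t : ℕ} (h : Hist K t) (a : Fin K) : ℝ :=
  (∑ s, if (h s).1 = a then (h s).2 else 0) / pulls h a

/-- The upper confidence bound of the arm `a`, for the horizon `T`. -/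
noncomputable def ucb (T : ℕ) {t : ℕ} (h : Hist K t) (a : Fin K) : ℝ :=
  empMean h a + √(3 * Real.log T / pulls h a)

/-- The radius of the confidence interval of the arm `a`. -/
noncomputable def radius (T : ℕ) {t : ℕ} (h : Hist K t) (a : Fin K) : ℝ :=
  ucb T h a - empMean h a

/-- The average, over `m` sampled mean vectors, of the mean of the best arm. -/
noncomputable def sampleOpt [NeZero K] {m : ℕ} (s : Fin m → Param K) : ℝ :=
  (∑ i, s i (optArm (s i))) / m

/-- The ratio that TS-UCB minimizes over the arms `a`. -/
noncomputable def ratio (T : ℕ) {t : ℕ} (h : Hist K t) (f : ℝ) (a : Fin K) : ℝ :=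
  (f - empMean h a) / radius T h a

/-- `π` is a TS-UCB policy with `m` posterior samples for the horizon `T`: the first `K` rounds pull
`K` different arms (in any order), and in every later round, for almost every history `h`, the
action is distributed as an arm that minimizes the ratio computed from `m` independent samples from
the posterior. In the joint law `ρ` of the samples and the arm, ties may be broken in any way,
which may be randomized and may depend on the history and on the samples. -/
structure IsTSUCB [NeZero K] (B : Model K) (m T : ℕ) (π : Policy K) : Prop where
  init : ∀ t < K, ∀ᵐ h ∂(histLaw B π t), ∀ᵐ a ∂(π.act t h), pulls h a = 0
  step : ∀ t, K ≤ t → ∀ᵐ h ∂(histLaw B π t),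
    ∃ ρ : Measure ((Fin m → Param K) × Fin K),
      ρ.fst = Measure.pi (fun _ => post B π t h) ∧
      ρ.snd = π.act t h ∧
      ∀ᵐ p ∂ρ, ∀ b, ratio T h (sampleOpt p.1) p.2 ≤ ratio T h (sampleOpt p.1) b

end Bandit

namespace Bandit

open scoped ENNReal

variable {K : ℕ}

/-! ### The law of the history -/

/-! Given the history, each posterior sample is distributed as `θ`, so `sampleOpt` has conditional
mean `E[max θ]` for every `m`. Conditionally, the regret of a round is therefore the mean of
`sampleOpt` minus `empMean` of the pulled arm, plus the gap between that `empMean` and the posterior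
mean of the arm.

For the first difference, the arm `a` pulled is compared with the arm `c` of largest UCB. Up to the
excess `d` of the sampled means over the UCBs, `sampleOpt` is at most `ucb c`, so the ratio at `c`,
hence at `a`, is at most `1 + d / radius c`. After all arms have been pulled, radii differ by a
factor of at most `√T`, so the difference is at most `radius a + √T * d`
(`sampleOpt_sub_empMean_le`). The second difference is at most `radius a` plus the amount by which
the true mean falls below its confidence interval. A round thus costs two radii plus errors
(`integral_roundRegret_post_le`).

By the tower property the errors may be averaged under the joint law of `θ` and the history. There
an exponential supermartingale from Hoeffding's lemma, with a union bound over the pull count, gives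
`T⁻⁵` per arm (`max_le_errBound`, `integral_errBound_le`), hence at most `2√T` over all rounds. The
radii telescope against the potential `∑ √(n - 1)`, which Cauchy–Schwarz bounds by `√(KT)`. The
initial rounds cost at most `K`. The term `T⁻²` and one `√T` in the bound are slack. -/

theorem lintegral_histKernel_succ (B : Model K) (π : Policy K) (t : ℕ) (θ : Param K)
    {F : Hist K (t + 1) → ℝ≥0∞} (hF : Measurable F) :
    ∫⁻ h, F h ∂(histKernel B π (t + 1) θ) =
      ∫⁻ h, ∫⁻ a, ∫⁻ r, F (extend (h, (a, r))) ∂(B.reward (θ, a)) ∂(π.act t h)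
        ∂(histKernel B π t θ) := by
  have hG : Measurable fun p : Hist K t × (Fin K × ℝ) => F (extend p) := hF.comp measurable_extend
  rw [histKernel, Kernel.lintegral_map _ measurable_extend _ hF, Kernel.lintegral_compProd _ _ _ hG]
  refine lintegral_congr fun h => ?_
  rw [round, Kernel.lintegral_compProd _ _ _ (f := fun q => F (extend (h, q)))
    (hG.comp measurable_prodMk_left)]
  simp [Kernel.comap_apply]

theorem lintegral_histLaw (B : Model K) (π : Policy K) (t : ℕ)
    {F : Hist K t → ℝ≥0∞} (hF : Measurable F) :
    ∫⁻ h, F h ∂(histLaw B π t) = ∫⁻ θ, ∫⁻ h, F h ∂(histKernel B π t θ) ∂B.prior := by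
  rw [histLaw, Measure.lintegral_bind (Kernel.aemeasurable _) hF.aemeasurable]

/-- For a functional blind to the newest reward, the reward kernel integrates to one. As the policy
sees only the history, `θ` then disappears from the recursion. -/
theorem lintegral_histLaw_succ (B : Model K) (π : Policy K) (t : ℕ)
    {F : Hist K (t + 1) → ℝ≥0∞} (hF : Measurable F) {G : Hist K t → Fin K → ℝ≥0∞}
    (hG : ∀ a, Measurable fun h => G h a) (hFG : ∀ h a r, F (extend (h, (a, r))) = G h a) :
    ∫⁻ h, F h ∂(histLaw B π (t + 1)) = ∫⁻ h, ∫⁻ a, G h a ∂(π.act t h) ∂(histLaw B π t) := by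
  have hG' : Measurable fun h => ∫⁻ a, G h a ∂(π.act t h) := by
    simp_rw [lintegral_fintype]
    exact Finset.measurable_sum _ fun a _ =>
      (hG a).mul (Kernel.measurable_coe _ (measurableSet_singleton a))
  rw [lintegral_histLaw _ _ _ hF, lintegral_histLaw _ _ _ hG']
  refine lintegral_congr fun θ => ?_
  simp [lintegral_histKernel_succ B π t θ hF, hFG]

theorem ae_histLaw_succ (B : Model K) (π : Policy K) (t : ℕ) {P : Hist K (t + 1) → Prop}
    (hP : MeasurableSet {h | P h}) {Q : Hist K t → Fin K → Prop}
    (hQ : ∀ a, MeasurableSet {h | Q h a}) (hPQ : ∀ h a r, P (extend (h, (a, r))) ↔ Q h a)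
    (hae : ∀ᵐ h ∂(histLaw B π t), ∀ᵐ a ∂(π.act t h), Q h a) :
    ∀ᵐ h ∂(histLaw B π (t + 1)), P h := by
  classical
  -- The indicator of failure has integral zero exactly when the property holds almost surely.
  have h1 := lintegral_histLaw_succ B π t (F := fun h => if P h then 0 else 1)
    (G := fun h a => if Q h a then 0 else 1) (Measurable.ite hP measurable_const measurable_const)
    (fun a => Measurable.ite (hQ a) measurable_const measurable_const)
    (fun h a r => by simp [hPQ])
  have h2 : ∫⁻ h, ∫⁻ a, (if Q h a then (0 : ℝ≥0∞) else 1) ∂(π.act t h) ∂(histLaw B π t) = 0 := by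
    rw [← lintegral_zero (μ := histLaw B π t)]
    refine lintegral_congr_ae ?_
    filter_upwards [hae] with h hh
    rw [← lintegral_zero (μ := π.act t h)]
    refine lintegral_congr_ae ?_
    filter_upwards [hh] with a ha
    simp [ha]
  rw [h2, lintegral_eq_zero_iff (Measurable.ite hP measurable_const measurable_const)] at h1
  filter_upwards [h1] with h hh
  by_contra hc
  simp [hc] at hh

instance (B : Model K) (π : Policy K) (t : ℕ) : IsProbabilityMeasure (histLaw B π t) := by
  unfold histLaw; infer_instance

instance (B : Model K) (π : Policy K) (t : ℕ) : IsMarkovKernel (post B π t) := by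
  unfold post; infer_instance

/-- The joint law of the mean vector and of the history of the first `t` rounds. -/
noncomputable abbrev joint (B : Model K) (π : Policy K) (t : ℕ) : Measure (Param K × Hist K t) :=
  B.prior ⊗ₘ histKernel B π t

theorem histLaw_compProd_post (B : Model K) (π : Policy K) (t : ℕ) :
    histLaw B π t ⊗ₘ post B π t = (joint B π t).map Prod.swap :=
  compProd_posterior_eq_map_swap

theorem ae_post_of_ae_prior (B : Model K) (π : Policy K) (t : ℕ) {P : Param K → Prop}
    (hP : MeasurableSet {θ | P θ}) (h : ∀ᵐ θ ∂B.prior, P θ) :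
    ∀ᵐ h ∂(histLaw B π t), ∀ᵐ θ ∂(post B π t h), P θ := by
  refine Measure.ae_ae_of_ae_compProd (p := fun x => P x.2) ?_
  rw [histLaw_compProd_post]
  refine (ae_map_iff measurable_swap.aemeasurable (measurable_snd hP)).2 ?_
  refine (Measure.ae_compProd_iff (measurable_fst hP)).2 ?_
  filter_upwards [h] with θ hθ
  exact ae_of_all _ fun _ => hθ

theorem integrable_swap_of_joint (B : Model K) (π : Policy K) (t : ℕ) {g : Param K × Hist K t → ℝ}
    (hg : Integrable g (joint B π t)) :
    Integrable (fun p => g p.swap) (histLaw B π t ⊗ₘ post B π t) := by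
  rw [histLaw_compProd_post]
  have := (MeasurableEquiv.prodComm (α := Param K) (β := Hist K t)).measurableEmbedding
  refine (this.integrable_map_iff (μ := joint B π t) (g := fun p => g p.swap)).2 ?_
  exact hg

/-- The tower property: it moves bounds between the posterior, where the arm is analysed, and the
joint law, where concentration holds. -/
theorem integral_post_eq_joint (B : Model K) (π : Policy K) (t : ℕ) {g : Param K × Hist K t → ℝ}
    (hg : Integrable g (joint B π t)) :
    ∫ h, ∫ θ, g (θ, h) ∂(post B π t h) ∂(histLaw B π t) = ∫ p, g p ∂(joint B π t) := by
  have h1 := Measure.integral_compProd (integrable_swap_of_joint B π t hg)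
  simp only [Prod.swap_prod_mk] at h1
  rw [← h1, histLaw_compProd_post]
  have := (MeasurableEquiv.prodComm (α := Param K) (β := Hist K t)).measurableEmbedding
  exact this.integral_map (μ := joint B π t) (g := fun p => g p.swap)

theorem integrable_integral_post (B : Model K) (π : Policy K) (t : ℕ)
    {g : Param K × Hist K t → ℝ} (hg : Integrable g (joint B π t)) :
    Integrable (fun h => ∫ θ, g (θ, h) ∂(post B π t h)) (histLaw B π t) := by
  have h1 := integrable_swap_of_joint B π t hg
  rw [Measure.compProd] at h1
  simpa using h1.integral_compProd

theorem ae_integrable_post (B : Model K) (π : Policy K) (t : ℕ)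
    {g : Param K × Hist K t → ℝ} (hg : Integrable g (joint B π t)) :
    ∀ᵐ h ∂(histLaw B π t), Integrable (fun θ => g (θ, h)) (post B π t h) := by
  have h1 := integrable_swap_of_joint B π t hg
  exact ((Measure.integrable_compProd_iff h1.1).1 h1).1

/-! ### The exponential supermartingale of an arm -/

/-- The exponential supermartingale of the centred rewards of the arm `b`. -/
noncomputable def expMart (l : ℝ) (b : Fin K) {t : ℕ} (θ : Param K) (h : Hist K t) : ℝ :=
  Real.exp (∑ s, if (h s).1 = b then l * ((h s).2 - θ b) - l ^ 2 / 8 else 0)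

theorem expMart_nonneg (l : ℝ) (b : Fin K) {t : ℕ} (θ : Param K) (h : Hist K t) :
    0 ≤ expMart l b θ h :=
  Real.exp_nonneg _

theorem measurable_expMart (l : ℝ) (b : Fin K) (t : ℕ) :
    Measurable fun p : Param K × Hist K t => expMart l b p.1 p.2 := by
  unfold expMart
  refine Real.measurable_exp.comp (Finset.measurable_sum _ fun s _ => ?_)
  refine Measurable.ite ?_ (by fun_prop) measurable_const
  exact (measurableSet_singleton b).preimage
    (f := fun p : Param K × Hist K t => (p.2 s).1) (by fun_prop)

theorem expMart_extend (l : ℝ) (b : Fin K) {t : ℕ} (θ : Param K) (h : Hist K t) (a : Fin K)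
    (r : ℝ) : expMart l b θ (extend (h, (a, r))) =
      expMart l b θ h * if a = b then Real.exp (l * (r - θ b) - l ^ 2 / 8) else 1 := by
  unfold expMart extend
  rw [Fin.sum_univ_castSucc, Real.exp_add]
  simp only [Fin.snoc_castSucc, Fin.snoc_last]
  congr 1
  split_ifs <;> simp

theorem lintegral_exp_reward_le_one (B : Model K) {θ : Param K} (l : ℝ) (b : Fin K)
    (hs : ∀ᵐ x ∂(B.reward (θ, b)), x ∈ Set.Icc (0 : ℝ) 1)
    (hm : ∫ x, x ∂(B.reward (θ, b)) = θ b) :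
    ∫⁻ r, ENNReal.ofReal (Real.exp (l * (r - θ b) - l ^ 2 / 8)) ∂(B.reward (θ, b)) ≤ 1 := by
  have h1 := hasSubgaussianMGF_of_mem_Icc (X := fun x : ℝ => x) (μ := B.reward (θ, b))
    measurable_id.aemeasurable hs
  have h2 := h1.mgf_le l
  have h3 := h1.integrable_exp_mul l
  simp only [hm, mgf] at h2 h3
  have h4 : ∀ r : ℝ, Real.exp (l * (r - θ b) - l ^ 2 / 8)
      = Real.exp (l * (r - θ b)) * Real.exp (-(l ^ 2 / 8)) := by
    intro r; rw [← Real.exp_add]; ring_nf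
  simp_rw [h4]
  rw [← ofReal_integral_eq_lintegral_ofReal (h3.mul_const _)
    (ae_of_all _ fun r => by positivity), integral_mul_const, ENNReal.ofReal_le_one]
  calc _ ≤ Real.exp (l ^ 2 / 8) * Real.exp (-(l ^ 2 / 8)) := by
        -- Hoeffding's lemma on an interval of length 1 has variance proxy `(1/2)² = 1/4`, hence
        -- exponent `l² / 8`.
        refine mul_le_mul_of_nonneg_right (h2.trans_eq ?_) (Real.exp_nonneg _)
        congr 1
        norm_num
        ring
    _ = 1 := by rw [← Real.exp_add]; simp

/-- A pull of `b` multiplies the process by a factor of mean at most 1, and a pull of any other arm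
leaves it unchanged. The adaptive choice of arms therefore does no harm. -/
theorem lintegral_expMart_le_one (B : Model K) (π : Policy K) {θ : Param K} (l : ℝ) (b : Fin K)
    (hs : ∀ᵐ x ∂(B.reward (θ, b)), x ∈ Set.Icc (0 : ℝ) 1)
    (hm : ∫ x, x ∂(B.reward (θ, b)) = θ b) (t : ℕ) :
    ∫⁻ h, ENNReal.ofReal (expMart l b θ h) ∂(histKernel B π t θ) ≤ 1 := by
  induction t with
  | zero => simp [expMart]
  | succ t ih =>
    have hmeas : Measurable fun h : Hist K (t + 1) => ENNReal.ofReal (expMart l b θ h) :=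
      ((measurable_expMart l b (t + 1)).comp measurable_prodMk_left).ennreal_ofReal
    rw [lintegral_histKernel_succ B π t θ hmeas]
    refine le_trans (lintegral_mono fun h => ?_) ih
    calc _ ≤ ∫⁻ _, ENNReal.ofReal (expMart l b θ h) ∂(π.act t h) := by
          refine lintegral_mono fun a => ?_
          simp_rw [expMart_extend]
          by_cases hab : a = b
          · subst hab
            have hmul (x : ℝ) := ENNReal.ofReal_mul (q := x) (expMart_nonneg l a θ h)
            simp only [if_true, hmul]
            rw [lintegral_const_mul _ (by fun_prop)]
            exact mul_le_of_le_one_right' (lintegral_exp_reward_le_one B l a hs hm)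
          · simp [hab]
      _ = _ := by simp

theorem integrable_expMart (B : Model K) (π : Policy K) (l : ℝ) (b : Fin K) (t : ℕ) :
    Integrable (fun p => expMart l b p.1 p.2) (joint B π t) ∧
      ∫ p, expMart l b p.1 p.2 ∂(joint B π t) ≤ 1 := by
  have hnn : ∀ p : Param K × Hist K t, 0 ≤ expMart l b p.1 p.2 := fun p => expMart_nonneg _ _ _ _
  have hM := measurable_expMart l b t
  have h1 : ∫⁻ p, ENNReal.ofReal (expMart l b p.1 p.2) ∂(joint B π t) ≤ 1 := by
    rw [Measure.lintegral_compProd hM.ennreal_ofReal]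
    calc _ ≤ ∫⁻ _, 1 ∂B.prior := by
          refine lintegral_mono_ae ?_
          filter_upwards [B.reward_support, B.reward_mean] with θ h1 h2
          exact lintegral_expMart_le_one B π l b (h1 b) (h2 b) t
      _ = 1 := by simp
  refine ⟨(lintegral_ofReal_ne_top_iff_integrable hM.aestronglyMeasurable (ae_of_all _ hnn)).1
    (h1.trans_lt ENNReal.one_lt_top).ne, ?_⟩
  rw [integral_eq_lintegral_of_nonneg_ae (ae_of_all _ hnn) hM.aestronglyMeasurable]
  exact ENNReal.toReal_mono ENNReal.one_ne_top h1

/-! ### Number of pulls, and the potential that bounds the sum of the radii -/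

theorem pulls_extend {t : ℕ} (h : Hist K t) (a : Fin K) (r : ℝ) (b : Fin K) :
    pulls (extend (h, (a, r))) b = pulls h b + if a = b then 1 else 0 := by
  unfold pulls extend
  simp only [Finset.card_filter]
  rw [Fin.sum_univ_castSucc]
  simp [Fin.snoc_castSucc, Fin.snoc_last]

theorem sum_pulls {t : ℕ} (h : Hist K t) : ∑ b, pulls h b = t := by
  unfold pulls
  rw [← Finset.card_eq_sum_card_fiberwise (f := fun s => (h s).1) (fun _ _ => by simp)]
  simp

theorem pulls_le {t : ℕ} (h : Hist K t) (b : Fin K) : pulls h b ≤ t :=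
  (Finset.single_le_sum (fun _ _ => Nat.zero_le _) (Finset.mem_univ b)).trans_eq (sum_pulls h)

theorem measurable_pulls (t : ℕ) (b : Fin K) : Measurable fun h : Hist K t => pulls h b := by
  unfold pulls
  simp only [Finset.card_filter]
  refine Finset.measurable_sum _ fun s _ => Measurable.ite ?_ measurable_const measurable_const
  exact (measurableSet_singleton b).preimage (f := fun h : Hist K t => (h s).1) (by fun_prop)

theorem radius_eq (T : ℕ) {t : ℕ} (h : Hist K t) (a : Fin K) :
    radius T h a = √(3 * Real.log T / pulls h a) := by
  simp [radius, ucb]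

theorem measurable_radius (T t : ℕ) (a : Fin K) : Measurable fun h : Hist K t => radius T h a := by
  simp only [radius_eq]
  have := measurable_pulls t a
  fun_prop

theorem radius_nonneg (T : ℕ) {t : ℕ} (h : Hist K t) (a : Fin K) : 0 ≤ radius T h a := by
  rw [radius_eq]; positivity

/-- The sum over the arms of `√(n - 1)`, where `n` is the number of pulls. -/
noncomputable def potential {t : ℕ} (h : Hist K t) : ℝ := ∑ b, √((pulls h b : ℝ) - 1)

theorem measurable_potential (t : ℕ) : Measurable fun h : Hist K t => potential h := by
  unfold potential
  refine Finset.measurable_sum _ fun b _ => ?_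
  have := measurable_pulls t b
  fun_prop

theorem potential_nonneg {t : ℕ} (h : Hist K t) : 0 ≤ potential h :=
  Finset.sum_nonneg fun _ _ => Real.sqrt_nonneg _

/-- Cauchy–Schwarz over the arms, whose pull counts sum to `t`. -/
theorem potential_le {t : ℕ} (h : Hist K t) : potential h ≤ √(K * t) := by
  refine Real.le_sqrt_of_sq_le ?_
  calc potential h ^ 2 ≤ (∑ b, √(pulls h b : ℝ)) ^ 2 := by
        refine pow_le_pow_left₀ (potential_nonneg h) (Finset.sum_le_sum fun b _ => ?_) 2
        exact Real.sqrt_le_sqrt (by linarith)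
    _ ≤ K * ∑ b, √(pulls h b : ℝ) ^ 2 := by
        simpa using sq_sum_le_card_mul_sum_sq (s := Finset.univ) (f := fun b => √(pulls h b : ℝ))
    _ = K * t := by
        simp only [Real.sq_sqrt (Nat.cast_nonneg _)]
        rw [← Nat.cast_sum, sum_pulls]

/-- The potential after a further pull of the arm `a`. -/
noncomputable def potentialNext {t : ℕ} (h : Hist K t) (a : Fin K) : ℝ :=
  ∑ b, √(((pulls h b + if a = b then 1 else 0 : ℕ) : ℝ) - 1)

theorem potential_extend {t : ℕ} (h : Hist K t) (a : Fin K) (r : ℝ) :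
    potential (extend (h, (a, r))) = potentialNext h a := by
  simp only [potential, potentialNext, pulls_extend]

theorem measurable_potentialNext (t : ℕ) (a : Fin K) :
    Measurable fun h : Hist K t => potentialNext h a := by
  unfold potentialNext
  refine Finset.measurable_sum _ fun b _ => ?_
  have := measurable_pulls t b
  refine Measurable.sqrt (Measurable.sub_const ?_ _)
  exact (measurable_of_countable (fun n : ℕ => ((n + if a = b then 1 else 0 : ℕ) : ℝ))).comp this

/-- A pull of `a` raises its term from `√(n - 1)` to `√n`, and `1/√n ≤ 2(√n - √(n - 1))`. The shift
by one in the potential is what aligns this increment with the radius before the pull. -/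
theorem radius_add_le_potentialNext (T : ℕ) {t : ℕ} (h : Hist K t) (a : Fin K)
    (ha : 1 ≤ pulls h a) :
    radius T h a + 2 * √(3 * Real.log T) * potential h ≤
      2 * √(3 * Real.log T) * potentialNext h a := by
  have hn : (1 : ℝ) ≤ pulls h a := by exact_mod_cast ha
  set n := (pulls h a : ℝ) with hn_def
  have h1 : potentialNext h a = potential h + (√n - √(n - 1)) := by
    unfold potentialNext potential
    rw [← Finset.add_sum_erase _ _ (Finset.mem_univ a),
      ← Finset.add_sum_erase (a := a) (f := fun b => √((pulls h b : ℝ) - 1)) _ (Finset.mem_univ a)]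
    have h2 : ∑ b ∈ Finset.univ.erase a, √(((pulls h b + if a = b then 1 else 0 : ℕ) : ℝ) - 1)
        = ∑ b ∈ Finset.univ.erase a, √((pulls h b : ℝ) - 1) := by
      refine Finset.sum_congr rfl fun b hb => ?_
      rw [if_neg (Finset.ne_of_mem_erase hb).symm, add_zero]
    rw [h2]
    simp only [if_true, Nat.cast_add, Nat.cast_one]
    rw [add_sub_cancel_right, ← hn_def]
    ring
  have hs : 0 < √n := Real.sqrt_pos.2 (by linarith)
  have h3 : 1 / √n ≤ 2 * (√n - √(n - 1)) := by
    rw [div_le_iff₀ hs]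
    nlinarith [Real.sq_sqrt (show 0 ≤ n by linarith), Real.sq_sqrt (show 0 ≤ n - 1 by linarith),
      sq_nonneg (√n - √(n - 1))]
  have h4 : radius T h a = √(3 * Real.log T) * (1 / √n) := by
    rw [radius_eq, Real.sqrt_div' _ (Nat.cast_nonneg _)]; ring
  rw [h1, h4]
  nlinarith [mul_le_mul_of_nonneg_left h3 (Real.sqrt_nonneg (3 * Real.log T))]

/-! ### Concentration of the empirical means -/

/-- An upper bound, of small expectation, for the amount by which `s * (empMean h b - θ b)`
exceeds the radius, where `s` is a sign. -/
noncomputable def errBound (T : ℕ) (s : ℝ) (b : Fin K) {t : ℕ} (θ : Param K) (h : Hist K t) : ℝ :=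
  (∑ n ∈ Finset.Icc 1 T, expMart (s * (4 * √(3 * Real.log T / n))) b θ h) / (T : ℝ) ^ 6

theorem errBound_nonneg (T : ℕ) (s : ℝ) (b : Fin K) {t : ℕ} (θ : Param K) (h : Hist K t) :
    0 ≤ errBound T s b θ h :=
  div_nonneg (Finset.sum_nonneg fun _ _ => expMart_nonneg _ _ _ _) (by positivity)

theorem integrable_errBound (B : Model K) (π : Policy K) (T : ℕ) (s : ℝ) (b : Fin K) (t : ℕ) :
    Integrable (fun p => errBound T s b p.1 p.2) (joint B π t) :=
  (integrable_finsetSum _ fun _ _ => (integrable_expMart B π _ b t).1).div_const _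

theorem integral_errBound_le (B : Model K) (π : Policy K) {T : ℕ} (hT : 1 ≤ T) (s : ℝ)
    (b : Fin K) (t : ℕ) : ∫ p, errBound T s b p.1 p.2 ∂(joint B π t) ≤ 1 / (T : ℝ) ^ 5 := by
  unfold errBound
  have hT' : (0 : ℝ) < T := by exact_mod_cast hT
  rw [integral_div, integral_finsetSum _ fun _ _ => (integrable_expMart B π _ b t).1]
  calc _ ≤ (∑ n ∈ Finset.Icc 1 T, (1 : ℝ)) / (T : ℝ) ^ 6 := by
        gcongr with n hn
        exact (integrable_expMart B π _ b t).2
    _ = 1 / (T : ℝ) ^ 5 := by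
        simp
        field_simp

theorem expMart_eq (l : ℝ) (b : Fin K) {t : ℕ} (θ : Param K) (h : Hist K t)
    (hb : 1 ≤ pulls h b) :
    expMart l b θ h =
      Real.exp (l * (pulls h b * (empMean h b - θ b)) - l ^ 2 / 8 * pulls h b) := by
  have hn : (pulls h b : ℝ) ≠ 0 := by positivity
  unfold expMart
  congr 1
  have h1 : ∀ s, (if (h s).1 = b then l * ((h s).2 - θ b) - l ^ 2 / 8 else 0)
      = l * (if (h s).1 = b then (h s).2 else 0)
        - (if (h s).1 = b then 1 else 0) * (l * θ b + l ^ 2 / 8) := by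
    intro s; split_ifs <;> ring
  have h2 : ∑ s, (if (h s).1 = b then (1 : ℝ) else 0) = pulls h b := by
    simp [pulls]
  rw [Finset.sum_congr rfl fun s _ => h1 s, Finset.sum_sub_distrib, ← Finset.mul_sum,
    ← Finset.sum_mul, h2, mul_sub (pulls h b : ℝ), empMean, mul_div_cancel₀ _ hn]
  ring

theorem three_mul_log_ge_one {T : ℕ} (hT : 2 ≤ T) : 1 ≤ 3 * Real.log T := by
  have h1 : Real.log 2 ≤ Real.log T := Real.log_le_log (by norm_num) (by exact_mod_cast hT)
  linarith [Real.log_two_gt_d9]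

/-- The exponent `4 * radius` depends on the random pull count `n`, so `errBound` sums over all
possible counts and the actual one is selected here. With `x` the excess, that summand equals `exp
(4 n r x)`, which dominates `x`. -/
theorem max_le_errBound {T : ℕ} (hT : 2 ≤ T) {s : ℝ} (hs : s ^ 2 = 1) (b : Fin K) {t : ℕ}
    (θ : Param K) (h : Hist K t) (hb : 1 ≤ pulls h b) (hbT : pulls h b ≤ T) :
    max (s * (empMean h b - θ b) - radius T h b) 0 ≤ errBound T s b θ h := by
  refine max_le ?_ (errBound_nonneg _ _ _ _ _)
  have hn : (1 : ℝ) ≤ pulls h b := by exact_mod_cast hb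
  have hL := three_mul_log_ge_one hT
  have hT' : (0 : ℝ) < T := by positivity
  have h1 : expMart (s * (4 * √(3 * Real.log T / pulls h b))) b θ h / (T : ℝ) ^ 6
      ≤ errBound T s b θ h := by
    unfold errBound
    refine div_le_div_of_nonneg_right ?_ (by positivity)
    exact Finset.single_le_sum
      (f := fun n : ℕ => expMart (s * (4 * √(3 * Real.log T / n))) b θ h)
      (fun n _ => expMart_nonneg _ _ _ _) (Finset.mem_Icc.2 ⟨hb, hbT⟩)
  refine le_trans ?_ h1
  rw [← radius_eq, expMart_eq _ _ _ _ hb]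
  have hr : radius T h b ^ 2 * pulls h b = 3 * Real.log T := by
    rw [radius_eq, Real.sq_sqrt (by positivity)]
    field_simp
  have hr0 := radius_nonneg T h b
  set r := radius T h b
  set n := (pulls h b : ℝ) with hn_def
  set x := s * (empMean h b - θ b) - r with hx
  have hT6 : (T : ℝ) ^ 6 = Real.exp (6 * Real.log T) := by
    rw [← Real.exp_log hT', ← Real.exp_nat_mul, Real.exp_log hT']; norm_num
  rw [hT6, ← Real.exp_sub]
  -- Since `r² n = 3 log T`, the drift `4 r² n` minus the compensator `2 r² n` is `6 log T`, which
  -- the factor `T⁶` cancels.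
  have h2 : s * (4 * r) * (n * (empMean h b - θ b)) - (s * (4 * r)) ^ 2 / 8 * n - 6 * Real.log T
      = 4 * (n * r) * x := by
    rw [show 6 * Real.log T = 2 * (r ^ 2 * n) by rw [hr]; ring, hx, mul_pow, hs]
    ring
  rw [h2]
  -- `(n r)² = n * (3 log T) ≥ 1`, so for `x > 0` one has `x ≤ 4 n r x ≤ exp (4 n r x)`.
  have hnr : 1 ≤ n * r := by
    rw [← one_le_sq_iff₀ (by positivity)]
    nlinarith
  rcases le_or_gt x 0 with h0 | h0
  · exact h0.trans (Real.exp_nonneg _)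
  · have := Real.add_one_le_exp (4 * (n * r) * x)
    nlinarith

/-! ### The choice of the arm -/

theorem sampleOpt_sub_empMean_le [NeZero K] {T : ℕ} (hT : 2 ≤ T) {m : ℕ} (hm : 1 ≤ m) {t : ℕ}
    (htT : t ≤ T) (h : Hist K t) (hpos : ∀ b, 1 ≤ pulls h b) (s : Fin m → Param K) (a : Fin K)
    (ha : ∀ b, ratio T h (sampleOpt s) a ≤ ratio T h (sampleOpt s) b) :
    sampleOpt s - empMean h a ≤
      radius T h a + √T * ((∑ i, ∑ b, max (s i b - ucb T h b) 0) / m) := by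
  obtain ⟨c, hc⟩ := Finite.exists_max (ucb T h)
  have hm' : (0 : ℝ) < m := by exact_mod_cast hm
  set d := (∑ i, ∑ b, max (s i b - ucb T h b) 0) / m with hd
  have hd0 : 0 ≤ d := by positivity
  have hf : sampleOpt s ≤ ucb T h c + d := by
    have h1 : ∑ i, s i (optArm (s i)) ≤ ∑ i, (ucb T h c + ∑ b, max (s i b - ucb T h b) 0) := by
      refine Finset.sum_le_sum fun i _ => ?_
      have h2 := Finset.single_le_sum (f := fun b => max (s i b - ucb T h b) 0)
        (fun b _ => le_max_right _ _) (Finset.mem_univ (optArm (s i)))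
      have h3 := le_max_left (s i (optArm (s i)) - ucb T h (optArm (s i))) 0
      have h4 := hc (optArm (s i))
      linarith
    unfold sampleOpt
    rw [div_le_iff₀ hm', add_mul, hd, div_mul_cancel₀ _ hm'.ne']
    refine h1.trans_eq ?_
    rw [Finset.sum_add_distrib]
    simp
    ring
  have hL := three_mul_log_ge_one hT
  have hn (b : Fin K) : (1 : ℝ) ≤ pulls h b := by exact_mod_cast hpos b
  have hrpos (b : Fin K) : 0 < radius T h b := by
    rw [radius_eq]
    have := hn b
    exact Real.sqrt_pos.2 (by positivity)
  -- Pull counts lie between 1 and `T`.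
  have hrr : radius T h a ≤ √T * radius T h c := by
    rw [radius_eq, radius_eq, ← Real.sqrt_mul (Nat.cast_nonneg _)]
    refine Real.sqrt_le_sqrt ?_
    have h1 := hn a
    have h2 := hn c
    have h3 : (pulls h c : ℝ) ≤ T := by exact_mod_cast (pulls_le h c).trans htT
    calc 3 * Real.log T / pulls h a ≤ 3 * Real.log T := div_le_self (by linarith) h1
      _ ≤ T * (3 * Real.log T / pulls h c) := by
        rw [← mul_div_assoc, le_div_iff₀ (by linarith)]
        nlinarith
  have h1 := ha c
  unfold ratio at h1
  rw [div_le_div_iff₀ (hrpos a) (hrpos c)] at h1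
  have h2 : sampleOpt s - empMean h c ≤ radius T h c + d := by
    unfold radius; linarith
  have h3 : (sampleOpt s - empMean h a) * radius T h c
      ≤ (radius T h a + √T * d) * radius T h c := by
    nlinarith [mul_le_mul_of_nonneg_right h2 (hrpos a).le, mul_le_mul_of_nonneg_right hrr hd0]
  exact le_of_mul_le_mul_right h3 (hrpos c)

/-! ### The regret of one round -/

/-- `optArm` is an arbitrary choice of maximizer, but the value it attains is a finite supremum of
coordinates. -/
theorem measurable_apply_optArm [NeZero K] : Measurable fun θ : Param K => θ (optArm θ) := by
  have h1 : (fun θ : Param K => θ (optArm θ)) =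
      Finset.univ.sup' Finset.univ_nonempty (fun (a : Fin K) (θ : Param K) => θ a) := by
    funext θ
    rw [Finset.sup'_apply]
    exact le_antisymm (Finset.le_sup' (fun a => θ a) (Finset.mem_univ _))
      (Finset.sup'_le _ _ fun a _ => le_optArm θ a)
  rw [h1]
  exact Finset.measurable_sup' _ fun a _ => measurable_pi_apply a

/-- The expected regret of the next round, given the mean vector and the history. -/
noncomputable def roundRegret [NeZero K] (π : Policy K) (t : ℕ) (θ : Param K) (h : Hist K t) : ℝ :=
  ∫ a, (θ (optArm θ) - θ a) ∂(π.act t h)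

theorem measurable_integral_act (π : Policy K) (t : ℕ) {β : Type*} [MeasurableSpace β]
    {f : β → Hist K t} (hf : Measurable f) {g : β → Fin K → ℝ}
    (hg : ∀ a, Measurable fun x => g x a) : Measurable fun x => ∫ a, g x a ∂(π.act t (f x)) := by
  simp_rw [integral_fintype (Integrable.of_finite), smul_eq_mul, measureReal_def]
  refine Finset.measurable_sum _ fun a _ => Measurable.mul ?_ (hg a)
  exact ((Kernel.measurable_coe _ (measurableSet_singleton a)).comp hf).ennreal_toReal

theorem measurable_roundRegret [NeZero K] (π : Policy K) (t : ℕ) :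
    Measurable fun p : Param K × Hist K t => roundRegret π t p.1 p.2 :=
  measurable_integral_act π t measurable_snd fun a =>
    (measurable_apply_optArm.comp measurable_fst).sub
      ((measurable_pi_apply a).comp measurable_fst)

theorem measurableSet_unitCube : MeasurableSet {θ : Param K | ∀ a, θ a ∈ Set.Icc (0 : ℝ) 1} := by
  simp only [Set.ofPred_forall]
  exact MeasurableSet.iInter fun a => measurableSet_Icc.preimage (measurable_pi_apply a)

theorem roundRegret_mem_Icc [NeZero K] (π : Policy K) (t : ℕ) {θ : Param K}
    (hθ : ∀ a, θ a ∈ Set.Icc (0 : ℝ) 1) (h : Hist K t) :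
    roundRegret π t θ h ∈ Set.Icc (0 : ℝ) 1 := by
  refine ⟨integral_nonneg fun a => sub_nonneg.2 (le_optArm θ a), ?_⟩
  calc roundRegret π t θ h ≤ ∫ _, (1 : ℝ) ∂(π.act t h) := by
        refine integral_mono Integrable.of_finite Integrable.of_finite fun a => ?_
        have h1 := (hθ (optArm θ)).2
        have h2 := (hθ a).1
        simp only
        linarith
    _ = 1 := by simp

theorem ae_joint_roundRegret_mem_Icc [NeZero K] (B : Model K) (π : Policy K) (t : ℕ) :
    ∀ᵐ p ∂(joint B π t), roundRegret π t p.1 p.2 ∈ Set.Icc (0 : ℝ) 1 := by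
  refine (Measure.ae_compProd_iff (measurableSet_Icc.preimage (measurable_roundRegret π t))).2 ?_
  filter_upwards [B.prior_support] with θ hθ
  exact ae_of_all _ fun h => roundRegret_mem_Icc π t hθ h

theorem integrable_roundRegret [NeZero K] (B : Model K) (π : Policy K) (t : ℕ) :
    Integrable (fun p => roundRegret π t p.1 p.2) (joint B π t) :=
  Integrable.of_mem_Icc 0 1 (measurable_roundRegret π t).aemeasurable
    (ae_joint_roundRegret_mem_Icc B π t)

theorem integral_roundRegret_le_one [NeZero K] (B : Model K) (π : Policy K) (t : ℕ) :
    ∫ p, roundRegret π t p.1 p.2 ∂(joint B π t) ≤ 1 := by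
  calc _ ≤ ∫ _, (1 : ℝ) ∂(joint B π t) := by
        refine integral_mono_ae (integrable_roundRegret B π t) (integrable_const _) ?_
        filter_upwards [ae_joint_roundRegret_mem_Icc B π t] with p hp using hp.2
    _ = 1 := by simp

theorem bayesRegret_eq_sum [NeZero K] (B : Model K) (T : ℕ) (π : Policy K) :
    bayesRegret B T π =
      ∑ t ∈ Finset.range T, ∫ p, roundRegret π t p.1 p.2 ∂(joint B π t) := by
  unfold bayesRegret regret
  have hint (t : ℕ) : Integrable (fun θ => ∫ h, roundRegret π t θ h ∂(histKernel B π t θ))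
      B.prior := by
    have h1 := integrable_roundRegret B π t
    rw [joint, Measure.compProd] at h1
    simpa using h1.integral_compProd
  refine (integral_finsetSum _ fun t _ => hint t).trans (Finset.sum_congr rfl fun t _ => ?_)
  exact (Measure.integral_compProd (integrable_roundRegret B π t)).symm

/-! ### All arms are pulled in the initial rounds -/

theorem IsTSUCB.ae_pulls_le_one [NeZero K] {B : Model K} {m T : ℕ} {π : Policy K}
    (hπ : IsTSUCB B m T π) (t : ℕ) (ht : t ≤ K) :
    ∀ᵐ h ∂(histLaw B π t), ∀ b, pulls h b ≤ 1 := by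
  induction t with
  | zero => exact ae_of_all _ fun h b => (pulls_le h b).trans zero_le_one
  | succ t ih =>
    refine ae_histLaw_succ B π t (P := fun h => ∀ b, pulls h b ≤ 1)
      (Q := fun h a => ∀ b, pulls h b + (if a = b then 1 else 0) ≤ 1) ?_ (fun a => ?_)
      (fun h a r => by simp only [pulls_extend]) ?_
    · simp only [Set.ofPred_forall]
      exact MeasurableSet.iInter fun b => measurableSet_le (measurable_pulls _ b) measurable_const
    · simp only [Set.ofPred_forall]
      exact MeasurableSet.iInter fun b =>
        measurableSet_le ((measurable_pulls _ b).add_const _) measurable_const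
    · filter_upwards [ih (by omega), hπ.init t (by omega)] with h h1 h2
      filter_upwards [h2] with a ha b
      have := h1 b
      split_ifs with hab
      · subst hab; omega
      · omega

theorem IsTSUCB.ae_one_le_pulls [NeZero K] {B : Model K} {m T : ℕ} {π : Policy K}
    (hπ : IsTSUCB B m T π) (t : ℕ) (ht : K ≤ t) :
    ∀ᵐ h ∂(histLaw B π t), ∀ b, 1 ≤ pulls h b := by
  induction t, ht using Nat.le_induction with
  | base =>
    filter_upwards [hπ.ae_pulls_le_one K le_rfl] with h hh b
    by_contra hb
    -- Pigeonhole: `K` pulls with at most one per arm leave no arm out.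
    have h1 : ∑ b, pulls h b < ∑ _b : Fin K, 1 :=
      Finset.sum_lt_sum (fun i _ => hh i) ⟨b, Finset.mem_univ _, by omega⟩
    rw [sum_pulls] at h1
    simp at h1
  | succ t ht ih =>
    refine ae_histLaw_succ B π t (P := fun h => ∀ b, 1 ≤ pulls h b)
      (Q := fun h a => ∀ b, 1 ≤ pulls h b + (if a = b then 1 else 0)) ?_ (fun a => ?_)
      (fun h a r => by simp only [pulls_extend]) ?_
    · simp only [Set.ofPred_forall]
      exact MeasurableSet.iInter fun b => measurableSet_le measurable_const (measurable_pulls _ b)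
    · simp only [Set.ofPred_forall]
      exact MeasurableSet.iInter fun b =>
        measurableSet_le measurable_const ((measurable_pulls _ b).add_const _)
    · filter_upwards [ih] with h hh
      exact ae_of_all _ fun a b => (hh b).trans (Nat.le_add_right _ _)

/-! ### The sum of the radii -/

theorem integrable_integral_radius (B : Model K) (π : Policy K) (T t : ℕ) (hpos : 1 ≤ T)
    (hae : ∀ᵐ h ∂(histLaw B π t), ∀ b, 1 ≤ pulls h b) :
    Integrable (fun h => ∫ a, radius T h a ∂(π.act t h)) (histLaw B π t) := by
  refine Integrable.of_mem_Icc 0 (√(3 * Real.log T))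
    (measurable_integral_act π t measurable_id fun a => measurable_radius T t a).aemeasurable ?_
  filter_upwards [hae] with h hh
  refine ⟨integral_nonneg fun a => radius_nonneg T h a, ?_⟩
  calc _ ≤ ∫ _, √(3 * Real.log T) ∂(π.act t h) := by
        refine integral_mono Integrable.of_finite Integrable.of_finite fun a => ?_
        simp only [radius_eq]
        refine Real.sqrt_le_sqrt (div_le_self ?_ (by exact_mod_cast hh a))
        have := Real.log_nonneg (show (1 : ℝ) ≤ T by exact_mod_cast hpos)
        positivity
    _ = _ := by simp

theorem integrable_potential (B : Model K) (π : Policy K) (t : ℕ) :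
    Integrable (fun h => potential h) (histLaw B π t) :=
  Integrable.of_mem_Icc 0 (√(K * t)) (measurable_potential t).aemeasurable
    (ae_of_all _ fun h => ⟨potential_nonneg h, potential_le h⟩)

theorem potentialNext_mem_Icc {t : ℕ} (h : Hist K t) (a : Fin K) :
    potentialNext h a ∈ Set.Icc 0 (√(K * (t + 1 : ℕ))) := by
  rw [← potential_extend h a 0]
  exact ⟨potential_nonneg _, potential_le _⟩

theorem integral_potential_succ (B : Model K) (π : Policy K) (t : ℕ) :
    ∫ h, potential h ∂(histLaw B π (t + 1)) =
      ∫ h, ∫ a, potentialNext h a ∂(π.act t h) ∂(histLaw B π t) := by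
  have hmeas : Measurable fun h => ∫ a, potentialNext h a ∂(π.act t h) :=
    measurable_integral_act π t measurable_id fun a => measurable_potentialNext t a
  rw [integral_eq_lintegral_of_nonneg_ae (ae_of_all _ potential_nonneg)
    (measurable_potential _).aestronglyMeasurable,
    integral_eq_lintegral_of_nonneg_ae
      (ae_of_all _ fun h => integral_nonneg fun a => (potentialNext_mem_Icc h a).1)
      hmeas.aestronglyMeasurable,
    lintegral_histLaw_succ B π t (measurable_potential _).ennreal_ofReal
      (G := fun h a => ENNReal.ofReal (potentialNext h a))
      (fun a => (measurable_potentialNext t a).ennreal_ofReal)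
      (fun h a r => by rw [potential_extend])]
  congr 1
  refine lintegral_congr fun h => ?_
  rw [ofReal_integral_eq_lintegral_ofReal Integrable.of_finite
    (ae_of_all _ fun a => (potentialNext_mem_Icc h a).1)]

theorem integral_radius_add_le (B : Model K) (π : Policy K) (T t : ℕ) (hpos : 1 ≤ T)
    (hae : ∀ᵐ h ∂(histLaw B π t), ∀ b, 1 ≤ pulls h b) :
    ∫ h, ∫ a, radius T h a ∂(π.act t h) ∂(histLaw B π t)
        + 2 * √(3 * Real.log T) * ∫ h, potential h ∂(histLaw B π t) ≤
      2 * √(3 * Real.log T) * ∫ h, potential h ∂(histLaw B π (t + 1)) := by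
  have hint : Integrable (fun h => ∫ a, potentialNext h a ∂(π.act t h)) (histLaw B π t) := by
    refine Integrable.of_mem_Icc 0 (√(K * (t + 1 : ℕ)))
      (measurable_integral_act π t measurable_id
        fun a => measurable_potentialNext t a).aemeasurable (ae_of_all _ fun h => ?_)
    refine ⟨integral_nonneg fun a => (potentialNext_mem_Icc h a).1, ?_⟩
    refine (integral_mono (g := fun _ => √(K * (t + 1 : ℕ))) Integrable.of_finite
      Integrable.of_finite fun a => (potentialNext_mem_Icc h a).2).trans ?_
    simp
  rw [integral_potential_succ, ← integral_const_mul, ← integral_const_mul,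
    ← integral_add (integrable_integral_radius B π T t hpos hae)
      ((integrable_potential B π t).const_mul _)]
  refine integral_mono_ae ((integrable_integral_radius B π T t hpos hae).add
      ((integrable_potential B π t).const_mul _)) (hint.const_mul _) ?_
  filter_upwards [hae] with h hh
  rw [← integral_const_mul]
  calc _ = ∫ a, (radius T h a + 2 * √(3 * Real.log T) * potential h) ∂(π.act t h) := by
        rw [integral_add Integrable.of_finite Integrable.of_finite]
        simp
    _ ≤ _ := integral_mono Integrable.of_finite Integrable.of_finite fun a =>
        radius_add_le_potentialNext T h a (hh a)

theorem sum_integral_radius_le (B : Model K) (π : Policy K) {T : ℕ} (hpos : 1 ≤ T) (n : ℕ)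
    (hae : ∀ t, K ≤ t → ∀ᵐ h ∂(histLaw B π t), ∀ b, 1 ≤ pulls h b) (hn : K ≤ n) :
    ∑ t ∈ Finset.Ico K n, ∫ h, ∫ a, radius T h a ∂(π.act t h) ∂(histLaw B π t) ≤
      2 * √(3 * Real.log T) * ∫ h, potential h ∂(histLaw B π n) := by
  induction n, hn using Nat.le_induction with
  | base =>
    simp only [Finset.Ico_self, Finset.sum_empty]
    have := integral_nonneg (μ := histLaw B π K) (f := fun h => potential h) potential_nonneg
    positivity
  | succ n hn ih =>
    rw [Finset.sum_Ico_succ_top hn]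
    linarith [integral_radius_add_le B π T n hpos (hae n hn)]

/-! ### The regret of a round of TS-UCB -/

/-- Only the two marginals of the coupling enter after integration, and the average of `m` samples
has mean `∫ f`. This is why neither `m` nor the tie-breaking rule affects the bound. -/
theorem integral_le_integral_of_coupling {α β : Type*} [MeasurableSpace α] [MeasurableSpace β]
    [Finite β] [MeasurableSingletonClass β] {m : ℕ} (hm : 1 ≤ m) {ν : Measure α}
    [IsProbabilityMeasure ν] {η : Measure β} [IsFiniteMeasure η] {ρ : Measure ((Fin m → α) × β)}
    (h1 : ρ.fst = Measure.pi fun _ => ν) (h2 : ρ.snd = η) {f : α → ℝ} (hf : Integrable f ν)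
    {g : β → ℝ} (hfg : ∀ᵐ p ∂ρ, (∑ i, f (p.1 i)) / m ≤ g p.2) :
    ∫ x, f x ∂ν ≤ ∫ y, g y ∂η := by
  have hm' : (m : ℝ) ≠ 0 := by positivity
  have hi (i : Fin m) : Integrable (fun s : Fin m → α => f (s i)) (Measure.pi fun _ => ν) :=
    integrable_comp_eval hf
  have hF : Integrable (fun s : Fin m → α => (∑ i, f (s i)) / m) (Measure.pi fun _ => ν) :=
    (integrable_finsetSum _ fun i _ => hi i).div_const _
  have hFint : ∫ s, (∑ i, f (s i)) / m ∂(Measure.pi fun _ : Fin m => ν) = ∫ x, f x ∂ν := by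
    rw [integral_div, integral_finsetSum _ fun i _ => hi i]
    simp_rw [integral_comp_eval (μ := fun _ : Fin m => ν) hf.1]
    simp
    field_simp
  have hg : Integrable g η := Integrable.of_finite
  rw [← hFint]
  rw [← h1] at hF ⊢
  rw [← h2] at hg ⊢
  rw [Measure.fst, Measure.snd] at *
  rw [integral_map measurable_fst.aemeasurable hF.1, integral_map measurable_snd.aemeasurable hg.1]
  exact integral_mono_ae (hF.comp_measurable measurable_fst) (hg.comp_measurable measurable_snd) hfg

theorem integral_roundRegret_post_le [NeZero K] {m T : ℕ} (hm : 1 ≤ m) (hT : 2 ≤ T)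
    (π : Policy K) {t : ℕ} (htT : t ≤ T) (h : Hist K t) (hpos : ∀ b, 1 ≤ pulls h b)
    (ν : Measure (Param K)) [IsProbabilityMeasure ν]
    (hν : ∀ᵐ θ ∂ν, ∀ a, θ a ∈ Set.Icc (0 : ℝ) 1)
    (hE : ∀ b, Integrable (fun θ => errBound T 1 b θ h) ν)
    (hE' : ∀ b, Integrable (fun θ => errBound T (-1) b θ h) ν)
    {ρ : Measure ((Fin m → Param K) × Fin K)} (h1 : ρ.fst = Measure.pi fun _ => ν)
    (h2 : ρ.snd = π.act t h)
    (hρ : ∀ᵐ p ∂ρ, ∀ b, ratio T h (sampleOpt p.1) p.2 ≤ ratio T h (sampleOpt p.1) b) :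
    ∫ θ, roundRegret π t θ h ∂ν ≤ 2 * ∫ a, radius T h a ∂(π.act t h)
      + ∫ θ, ∑ b, (√T * errBound T (-1) b θ h + errBound T 1 b θ h) ∂ν := by
  have hθ (a : Fin K) : Integrable (fun θ : Param K => θ a) ν := by
    refine Integrable.of_mem_Icc 0 1 (measurable_pi_apply a).aemeasurable ?_
    filter_upwards [hν] with θ hh using hh a
  have hopt : Integrable (fun θ : Param K => θ (optArm θ)) ν := by
    refine Integrable.of_mem_Icc 0 1 measurable_apply_optArm.aemeasurable ?_
    filter_upwards [hν] with θ hh using hh _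
  -- Given the history, the arm is independent of `θ`, so the two integrals may be exchanged.
  have hreg : ∫ θ, roundRegret π t θ h ∂ν =
      ∫ θ, θ (optArm θ) ∂ν - ∫ a, ∫ θ, θ a ∂ν ∂(π.act t h) := by
    have h3 (θ : Param K) : roundRegret π t θ h =
        θ (optArm θ) - ∑ a, (π.act t h).real {a} * θ a := by
      rw [roundRegret, integral_sub Integrable.of_finite Integrable.of_finite,
        integral_fintype (f := fun a => θ a) Integrable.of_finite]
      simp
    simp_rw [h3]
    rw [integral_sub hopt (integrable_finsetSum _ fun a _ => (hθ a).const_mul _),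
      integral_finsetSum _ fun a _ => (hθ a).const_mul _,
      integral_fintype (f := fun a => ∫ θ : Param K, θ a ∂ν) Integrable.of_finite]
    simp_rw [integral_const_mul, smul_eq_mul]
  have hN (b : Fin K) : pulls h b ≤ T := (pulls_le h b).trans htT
  have hpp (b : Fin K) : Integrable (fun θ : Param K => max (θ b - ucb T h b) 0) ν :=
    ((hθ b).sub (integrable_const _)).pos_part
  have hS : Integrable (fun θ : Param K => ∑ b, max (θ b - ucb T h b) 0) ν :=
    integrable_finsetSum _ fun b _ => hpp b
  have hcoup : ∫ θ, (θ (optArm θ) - √T * ∑ b, max (θ b - ucb T h b) 0) ∂ν ≤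
      ∫ a, (empMean h a + radius T h a) ∂(π.act t h) := by
    refine integral_le_integral_of_coupling hm h1 h2 (hopt.sub (hS.const_mul _)) ?_
    filter_upwards [hρ] with p hp
    have h3 := sampleOpt_sub_empMean_le hT hm htT h hpos p.1 p.2 hp
    simp only [Pi.sub_apply]
    rw [Finset.sum_sub_distrib, sub_div, ← Finset.mul_sum, mul_div_assoc]
    simp only [sampleOpt] at h3
    linarith
  rw [integral_sub hopt (hS.const_mul _), integral_const_mul,
    integral_add Integrable.of_finite Integrable.of_finite] at hcoup
  have hlow : ∫ θ, ∑ b, max (θ b - ucb T h b) 0 ∂ν ≤ ∑ b, ∫ θ, errBound T (-1) b θ h ∂ν := by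
    rw [integral_finsetSum _ fun b _ => hpp b]
    refine Finset.sum_le_sum fun b _ => integral_mono (hpp b) (hE' b) fun θ => ?_
    have h3 := max_le_errBound hT (s := -1) (by norm_num) b θ h (hpos b) (hN b)
    have h4 : -1 * (empMean h b - θ b) - radius T h b = θ b - ucb T h b := by
      unfold radius; ring
    rwa [h4] at h3
  -- The error of the pulled arm is bounded by the sum of the errors of all arms, which no longer
  -- depends on the choice.
  have hup : ∫ a, empMean h a ∂(π.act t h) - ∫ a, ∫ θ, θ a ∂ν ∂(π.act t h) ≤
      ∫ a, radius T h a ∂(π.act t h) + ∑ b, ∫ θ, errBound T 1 b θ h ∂ν := by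
    have h3 : ∫ a, (empMean h a - ∫ θ, θ a ∂ν) ∂(π.act t h) ≤
        ∫ a, (radius T h a + ∑ b, ∫ θ, errBound T 1 b θ h ∂ν) ∂(π.act t h) := by
      refine integral_mono Integrable.of_finite Integrable.of_finite fun a => ?_
      have h4 : ∫ θ, (empMean h a - radius T h a - θ a) ∂ν ≤ ∫ θ, errBound T 1 a θ h ∂ν := by
        refine integral_mono ((integrable_const _).sub (hθ a)) (hE a) fun θ => ?_
        have h5 := (le_max_left _ _).trans
          (max_le_errBound hT (s := 1) (by norm_num) a θ h (hpos a) (hN a))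
        simp only
        linarith
      rw [integral_sub (integrable_const _) (hθ a), integral_const] at h4
      have h5 := Finset.single_le_sum (f := fun b => ∫ θ, errBound T 1 b θ h ∂ν)
        (fun b _ => integral_nonneg fun θ => errBound_nonneg T 1 b θ h) (Finset.mem_univ a)
      simp at h4 h5 ⊢
      linarith
    rw [integral_sub Integrable.of_finite Integrable.of_finite,
      integral_add Integrable.of_finite Integrable.of_finite] at h3
    simpa using h3
  have hsum : ∫ θ, ∑ b, (√T * errBound T (-1) b θ h + errBound T 1 b θ h) ∂ν =
      √T * ∑ b, ∫ θ, errBound T (-1) b θ h ∂ν + ∑ b, ∫ θ, errBound T 1 b θ h ∂ν := by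
    have hb (b : Fin K) : Integrable
        (fun θ => √T * errBound T (-1) b θ h + errBound T 1 b θ h) ν :=
      ((hE' b).const_mul _).add (hE b)
    rw [integral_finsetSum _ fun b _ => hb b, Finset.mul_sum,
      ← Finset.sum_add_distrib]
    refine Finset.sum_congr rfl fun b _ => ?_
    rw [integral_add ((hE' b).const_mul _) (hE b), integral_const_mul]
  rw [hreg, hsum]
  linarith [mul_le_mul_of_nonneg_left hlow (Real.sqrt_nonneg (T : ℝ))]

theorem integrable_sum_errBound (B : Model K) (π : Policy K) (T t : ℕ) :
    Integrable (fun p : Param K × Hist K t =>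
      ∑ b, (√T * errBound T (-1) b p.1 p.2 + errBound T 1 b p.1 p.2)) (joint B π t) :=
  integrable_finsetSum _ fun b _ =>
    ((integrable_errBound B π T (-1) b t).const_mul _).add (integrable_errBound B π T 1 b t)

theorem integral_sum_errBound_le (B : Model K) (π : Policy K) {T : ℕ} (hT : 1 ≤ T) (hKT : K ≤ T)
    (t : ℕ) :
    ∫ p, ∑ b, (√T * errBound T (-1) b p.1 p.2 + errBound T 1 b p.1 p.2) ∂(joint B π t)
      ≤ 2 * √T / T := by
  have hb (b : Fin K) : Integrable (fun p : Param K × Hist K t =>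
      √T * errBound T (-1) b p.1 p.2 + errBound T 1 b p.1 p.2) (joint B π t) :=
    ((integrable_errBound B π T (-1) b t).const_mul _).add (integrable_errBound B π T 1 b t)
  have hT1 : (1 : ℝ) ≤ T := by exact_mod_cast hT
  have hs : 1 ≤ √(T : ℝ) := Real.one_le_sqrt.2 hT1
  rw [integral_finsetSum _ fun b _ => hb b]
  calc _ ≤ ∑ _b : Fin K, 2 * √T * (1 / (T : ℝ) ^ 5) := by
        refine Finset.sum_le_sum fun b _ => ?_
        rw [integral_add ((integrable_errBound B π T (-1) b t).const_mul _)
          (integrable_errBound B π T 1 b t), integral_const_mul]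
        have h1 := integral_errBound_le B π hT (-1) b t
        have h2 := integral_errBound_le B π hT 1 b t
        have h3 : 0 ≤ 1 / (T : ℝ) ^ 5 := by positivity
        nlinarith
    _ = 2 * √T * (K / (T : ℝ) ^ 5) := by simp; ring
    -- The union over arms is absorbed through `K ≤ T`.
    _ ≤ 2 * √T * (1 / T) := by
        refine mul_le_mul_of_nonneg_left ?_ (by positivity)
        rw [div_le_div_iff₀ (by positivity) (by positivity), one_mul]
        have hK : (K : ℝ) ≤ T := by exact_mod_cast hKT
        calc (K : ℝ) * T ≤ (T : ℝ) ^ 2 := by nlinarith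
          _ ≤ (T : ℝ) ^ 5 := pow_le_pow_right₀ hT1 (by norm_num)
    _ = 2 * √T / T := by ring

theorem ae_integrable_errBound_post (B : Model K) (π : Policy K) (T t : ℕ) (s : ℝ) :
    ∀ᵐ h ∂(histLaw B π t), ∀ b,
      Integrable (fun θ => errBound T s b θ h) (post B π t h) :=
  ae_all_iff.2 fun b => ae_integrable_post B π t
    (g := fun p => errBound T s b p.1 p.2) (integrable_errBound B π T s b t)

theorem IsTSUCB.ae_integral_roundRegret_post_le [NeZero K] {B : Model K} {m T : ℕ} {π : Policy K}
    (hπ : IsTSUCB B m T π) (hm : 1 ≤ m) (hT : 2 ≤ T) {t : ℕ} (hKt : K ≤ t) (htT : t ≤ T) :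
    ∀ᵐ h ∂(histLaw B π t), ∫ θ, roundRegret π t θ h ∂(post B π t h) ≤
      2 * ∫ a, radius T h a ∂(π.act t h) + ∫ θ, ∑ b, (√T * errBound T (-1) b θ h
        + errBound T 1 b θ h) ∂(post B π t h) := by
  filter_upwards [hπ.ae_one_le_pulls t hKt, ae_integrable_errBound_post B π T t 1,
    ae_integrable_errBound_post B π T t (-1), hπ.step t hKt,
    ae_post_of_ae_prior B π t measurableSet_unitCube B.prior_support]
    with h hh hh1 hh2 ⟨ρ, hρ1, hρ2, hρ3⟩ hν
  exact integral_roundRegret_post_le hm hT π htT h hh (post B π t h) hν hh1 hh2 hρ1 hρ2 hρ3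

theorem IsTSUCB.integral_roundRegret_le [NeZero K] {B : Model K} {m T : ℕ} {π : Policy K}
    (hπ : IsTSUCB B m T π) (hm : 1 ≤ m) (hT : 2 ≤ T) (hKT : K ≤ T) {t : ℕ} (hKt : K ≤ t)
    (htT : t ≤ T) :
    ∫ p, roundRegret π t p.1 p.2 ∂(joint B π t) ≤
      2 * ∫ h, ∫ a, radius T h a ∂(π.act t h) ∂(histLaw B π t) + 2 * √T / T := by
  have hT1 : 1 ≤ T := one_le_two.trans hT
  have hrad := integrable_integral_radius B π T t hT1 (hπ.ae_one_le_pulls t hKt)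
  have hR := integrable_roundRegret B π t
  have hW := integrable_sum_errBound B π T t
  have hR' := integrable_integral_post B π t hR
  have hW' := integrable_integral_post B π t hW
  refine le_trans ?_ (add_le_add_right (integral_sum_errBound_le B π hT1 hKT t) _)
  rw [← integral_post_eq_joint B π t hR, ← integral_post_eq_joint B π t hW, ← integral_const_mul,
    ← integral_add (hrad.const_mul 2) hW']
  exact integral_mono_ae hR' ((hrad.const_mul 2).add hW')
    (hπ.ae_integral_roundRegret_post_le hm hT hKt htT)

theorem IsTSUCB.bayesRegret_le [NeZero K] {B : Model K} {m T : ℕ} {π : Policy K}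
    (hπ : IsTSUCB B m T π) (hm : 1 ≤ m) (hKT : K ≤ T) :
    bayesRegret B T π ≤
      4 * √(3 * K * T * Real.log T) + 1 / (T : ℝ) ^ 2 + 3 * √(T : ℝ) + K := by
  have hK : 1 ≤ K := NeZero.one_le
  have hT : 1 ≤ T := hK.trans hKT
  have hT0 : (0 : ℝ) < T := by exact_mod_cast hT
  rw [bayesRegret_eq_sum, ← Finset.sum_range_add_sum_Ico _ hKT]
  have hinit : ∑ t ∈ Finset.range K, ∫ p, roundRegret π t p.1 p.2 ∂(joint B π t) ≤ K := by
    refine (Finset.sum_le_sum fun t _ => integral_roundRegret_le_one B π t).trans ?_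
    simp
  have hmain : ∑ t ∈ Finset.Ico K T, ∫ p, roundRegret π t p.1 p.2 ∂(joint B π t) ≤
      4 * √(3 * K * T * Real.log T) + 2 * √(T : ℝ) := by
    calc _ ≤ ∑ t ∈ Finset.Ico K T,
          (2 * ∫ h, ∫ a, radius T h a ∂(π.act t h) ∂(histLaw B π t) + 2 * √T / T) := by
          refine Finset.sum_le_sum fun t ht => ?_
          obtain ⟨h1, h2⟩ := Finset.mem_Ico.1 ht
          -- `1 ≤ K ≤ t < T` forces `2 ≤ T`; for `T = 1` there is no round after the initial ones.
          exact hπ.integral_roundRegret_le hm (by omega) hKT h1 h2.le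
      _ = 2 * ∑ t ∈ Finset.Ico K T, ∫ h, ∫ a, radius T h a ∂(π.act t h) ∂(histLaw B π t)
          + ((T - K : ℕ) : ℝ) * (2 * √T / T) := by
          rw [Finset.sum_add_distrib, ← Finset.mul_sum]
          simp
      _ ≤ 2 * (2 * √(3 * Real.log T) * √(K * T)) + T * (2 * √T / T) := by
          have h1 := sum_integral_radius_le B π hT T hπ.ae_one_le_pulls hKT
          have h2 : ∫ h, potential h ∂(histLaw B π T) ≤ √(K * T) := by
            refine (integral_mono (g := fun _ => √(K * T)) (integrable_potential B π T)
              (integrable_const _) potential_le).trans ?_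
            simp
          have h3 : ((T - K : ℕ) : ℝ) ≤ T := by exact_mod_cast Nat.sub_le _ _
          gcongr
          exact h1.trans (mul_le_mul_of_nonneg_left h2 (by positivity))
      _ = _ := by
          rw [mul_div_cancel₀ _ hT0.ne', mul_assoc 2 √(3 * Real.log T),
            ← Real.sqrt_mul (mul_nonneg (by norm_num)
              (Real.log_nonneg (by exact_mod_cast hT)))]
          rw [show 3 * Real.log T * (K * T) = 3 * K * T * Real.log T by ring]
          ring
  have h1 : 0 ≤ 1 / (T : ℝ) ^ 2 := by positivity
  linarith [Real.sqrt_nonneg (T : ℝ)]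

theorem exists_bound_le_mul_sqrt : ∃ C : ℝ, ∀ K T : ℕ, 1 ≤ K → K ≤ T → 2 ≤ T →
    4 * √(3 * K * T * Real.log T) + 1 / (T : ℝ) ^ 2 + 3 * √(T : ℝ) + K ≤
      C * √(K * T * Real.log T) := by
  -- The coefficients add up to `4 + 1 + 3 + 1`, and each term is compared with `√3 * √X`, using `3
  -- log T ≥ 1`.
  refine ⟨9 * √3, fun K T hK hKT hT => ?_⟩
  have hK' : (1 : ℝ) ≤ K := by exact_mod_cast hK
  have hKT' : (K : ℝ) ≤ T := by exact_mod_cast hKT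
  have hL := three_mul_log_ge_one hT
  set X : ℝ := K * T * Real.log T with hX
  have h0 : √(3 * K * T * Real.log T) = √3 * √X := by
    rw [← Real.sqrt_mul (by norm_num), hX]; ring_nf
  have hKX : (K : ℝ) * T ≤ 3 * X := by
    rw [hX]; nlinarith [mul_nonneg (show (0 : ℝ) ≤ K by linarith) (show (0 : ℝ) ≤ T by linarith)]
  have h1 : (K : ℝ) ≤ √3 * √X := by
    rw [← Real.sqrt_mul (by norm_num)]
    exact Real.le_sqrt_of_sq_le (by nlinarith)
  have h2 : √(T : ℝ) ≤ √3 * √X := by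
    rw [← Real.sqrt_mul (by norm_num)]
    exact Real.sqrt_le_sqrt (by nlinarith)
  have h3 : 1 / (T : ℝ) ^ 2 ≤ 1 := by
    rw [div_le_one (by positivity)]
    exact one_le_pow₀ (by linarith)
  rw [h0]
  linarith

end Bandit

theorem theorem1 :
    (∀ (K : ℕ) [NeZero K] (B : Bandit.Model K) (m T : ℕ) (π : Bandit.Policy K),
      1 ≤ m → K ≤ T → Bandit.IsTSUCB B m T π →
        Bandit.bayesRegret B T π ≤
          4 * √(3 * K * T * Real.log T) + 1 / (T : ℝ) ^ 2 + 3 * √(T : ℝ) + K) ∧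
    (∃ C : ℝ, ∀ K T : ℕ, 1 ≤ K → K ≤ T → 2 ≤ T →
      4 * √(3 * K * T * Real.log T) + 1 / (T : ℝ) ^ 2 + 3 * √(T : ℝ) + K ≤
        C * √(K * T * Real.log T)) :=
  ⟨fun _ _ _ _ _ _ hm hKT hπ => hπ.bayesRegret_le hm hKT, Bandit.exists_bound_le_mul_sqrt⟩
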